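/- Let $\tau$ be in the upper half plane and let $$\theta_1(z)=\theta_1(z|\tau)=\sum_{k\in\mathbb Z}\exp\Big[2\pi i\Big(\big(z+\tfrac12\big)\big(k+\tfrac12\big)+\tfrac12\big(k+\tfrac12\big)^2\tau\Big)\Big].$$ Let $\varepsilon_1,\varepsilon_2$ be the basis of the weight space $\mathbb C\varepsilon_1\oplus\mathbb C\varepsilon_2$ of $\mathfrak{sp}(4,\mathbb C)$, with the complex bilinear form $(\varepsilon_j,\varepsilon_k)=\tfrac12\delta_{jk}$, and for weights $\lambda,p$ put $\lambda_p=(\lambda,p)$. For $\hbar\in\mathbb C$ put $$U(\lambda_p,\lambda_q)=\frac{\theta_1(2\hbar)}{\theta_1(6\hbar)}\,\frac{\theta_1(2\lambda_p+2\hbar)\,\theta_1(2\lambda_q+2\hbar)}{\theta_1(2\lambda_p)\,\theta_1(2\lambda_q)}\,\frac{\theta_1(\lambda_{p+q}-5\hbar)\,\theta_1(\lambda_{p+q}+2\hbar)}{\theta_1(\lambda_{p+q})\,\theta_1(\lambda_{p+q}+\hbar)}.$$ Then, for all $\hbar\in\mathbb C$ and all weights $\lambda$ for which none of the denominators below (including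 those in $U$) vanishes, $$\sum_{\substack{p=\pm\varepsilon_1\\ q=\pm\varepsilon_2}}U(\lambda_p,\lambda_q)-\sum_{\substack{p=\pm\varepsilon_1\\ q=\pm\varepsilon_2}}\frac{\theta_1(\lambda_{p+q}-\hbar)\,\theta_1(\lambda_{p+q}+2\hbar)}{\theta_1(\lambda_{p+q})\,\theta_1(\lambda_{p+q}+\hbar)}=K,$$ where $K$ is the constant, independent of $\lambda$, given by $$K=-\left(\frac{\theta_1(8\hbar)\,\theta_1(\hbar)}{\theta_1(6\hbar)\,\theta_1(5\hbar)}+\frac{\theta_1(5\hbar)\,\theta_1(2\hbar)}{\theta_1(4\hbar)\,\theta_1(3\hbar)}+\frac{\theta_1(6\hbar)\,\theta_1(3\hbar)}{\theta_1(5\hbar)\,\theta_1(4\hbar)}+\frac{\theta_1(4\hbar)\,\theta_1(\hbar)}{\theta_1(3\hbar)\,\theta_1(2\hbar)}\right).$$ -/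

import Mathlib

noncomputable section

namespace C2Theta

/-- The Jacobi theta function `θ₁(z | τ)`, by its defining series over the integers. -/
def theta1 (τ : UpperHalfPlane) (z : ℂ) : ℂ :=
  ∑' k : ℤ, Complex.exp (2 * Real.pi * Complex.I *
    ((z + 1 / 2) * ((k : ℂ) + 1 / 2) + 1 / 2 * ((k : ℂ) + 1 / 2) ^ 2 * (τ : ℂ)))

/-- The weight space of `sp(4, ℂ)`, in coordinates with respect to the basis `ε₁, ε₂`
(indexed here by `0, 1`). -/
abbrev Weight : Type := Fin 2 → ℂ

/-- The basis vectors: `ε 0` is `ε₁` and `ε 1` is `ε₂`. -/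
def ε (j : Fin 2) : Weight := Pi.single j 1

/-- The normalized (complex bilinear) Killing form: `(ε_j, ε_k) = δ_{jk} / 2`. -/
def form (x y : Weight) : ℂ := 1 / 2 * ∑ j : Fin 2, x j * y j

/-- The function `U(x, y)`, with step parameter `h`; it is used at `x = λ_p`, `y = λ_q`,
where `λ_{p+q} = x + y`. -/
def U (τ : UpperHalfPlane) (h x y : ℂ) : ℂ :=
  theta1 τ (2 * h) / theta1 τ (6 * h) *
    ((theta1 τ (2 * x + 2 * h) * theta1 τ (2 * y + 2 * h)) /
      (theta1 τ (2 * x) * theta1 τ (2 * y))) *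
    ((theta1 τ (x + y - 5 * h) * theta1 τ (x + y + 2 * h)) /
      (theta1 τ (x + y) * theta1 τ (x + y + h)))

/-- The constant `K`, a function of `τ` and `h` only. -/
def K (τ : UpperHalfPlane) (h : ℂ) : ℂ :=
  -(theta1 τ (8 * h) * theta1 τ h / (theta1 τ (6 * h) * theta1 τ (5 * h))
    + theta1 τ (5 * h) * theta1 τ (2 * h) / (theta1 τ (4 * h) * theta1 τ (3 * h))
    + theta1 τ (6 * h) * theta1 τ (3 * h) / (theta1 τ (5 * h) * theta1 τ (4 * h))
    + theta1 τ (4 * h) * theta1 τ h / (theta1 τ (3 * h) * theta1 τ (2 * h)))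

end C2Theta

end

/-! ### Quasi-periodicity and oddness of θ₁. -/

noncomputable section
namespace C2Theta
open Complex

/-! Put x = λ_{ε₁}, y = λ_{ε₂}. The left side is `signSum`, even in x and symmetric in x, y.
Multiplied by the product `den` of theta functions it becomes `num`; as functions of x, both are odd
theta functions of degree 10 with zero total shift.

Odd theta functions of degree 2m + 2 form a space of dimension at most m: quasi-periodicity links
the Fourier coefficients k and k + 2m + 2, oddness links k and -k, and only the indices 1, …, m stay
free. Hence m values at points in general position determine such a function
(`IsTheta.eq_zero_of_odd`). Here m = 4. At x = y, y + h, y - h the residues of `signSum` cancel, so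
`num` vanishes there along with `den`; one further point x' forces `num` and `den` to be
proportional. So `signSum` does not depend on x, nor, by symmetry, on y, and its value at (-h, -3h)
is K.

This argument needs more quantities to be nonzero than the theorem assumes. It is run at nearby
generic (h, x, y), and the identity passes to the limit by continuity. -/

lemma theta1_eq_jacobiTheta₂ (τ : UpperHalfPlane) (z : ℂ) :
    theta1 τ z = exp (Real.pi * I * (z + 1 / 2) + Real.pi * I * τ / 4) *
      jacobiTheta₂ (z + 1 / 2 + τ / 2) τ := by
  rw [theta1, jacobiTheta₂, ← tsum_mul_left]
  refine tsum_congr fun k => ?_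
  rw [jacobiTheta₂_term, ← Complex.exp_add]
  ring_nf

lemma differentiable_theta1 (τ : UpperHalfPlane) : Differentiable ℂ (theta1 τ) := by
  have h : theta1 τ = fun z => exp (Real.pi * I * (z + 1 / 2) + Real.pi * I * τ / 4) *
      jacobiTheta₂ (z + 1 / 2 + τ / 2) τ := funext (theta1_eq_jacobiTheta₂ τ)
  rw [h]
  have h2 : Differentiable ℂ fun z => jacobiTheta₂ z (τ : ℂ) :=
    fun z => differentiableAt_jacobiTheta₂_fst z τ.im_pos
  have h3 : Differentiable ℂ fun z : ℂ => jacobiTheta₂ (z + 1 / 2 + τ / 2) (τ : ℂ) :=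
    h2.comp (by fun_prop : Differentiable ℂ fun z : ℂ => z + 1 / 2 + (τ : ℂ) / 2)
  exact Differentiable.mul (by fun_prop) h3

lemma theta1_add_one (τ : UpperHalfPlane) (z : ℂ) : theta1 τ (z + 1) = -theta1 τ z := by
  rw [theta1_eq_jacobiTheta₂, theta1_eq_jacobiTheta₂,
    show z + 1 + 1 / 2 + (τ : ℂ) / 2 = z + 1 / 2 + τ / 2 + 1 by ring, jacobiTheta₂_add_left,
    show Real.pi * I * (z + 1 + 1 / 2) + Real.pi * I * τ / 4 =
      (Real.pi * I * (z + 1 / 2) + Real.pi * I * τ / 4) + Real.pi * I by ring, Complex.exp_add,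
    Complex.exp_pi_mul_I]
  ring

lemma theta1_add_tau (τ : UpperHalfPlane) (z : ℂ) :
    theta1 τ (z + τ) = -(exp (-(Real.pi * I * τ) - 2 * Real.pi * I * z) * theta1 τ z) := by
  rw [theta1_eq_jacobiTheta₂, theta1_eq_jacobiTheta₂,
    show z + (τ : ℂ) + 1 / 2 + (τ : ℂ) / 2 = z + 1 / 2 + τ / 2 + τ by ring, jacobiTheta₂_add_left',
    ← mul_assoc, ← mul_assoc, ← Complex.exp_add, ← Complex.exp_add, ← neg_mul]
  congr 1
  rw [← Complex.exp_sub_pi_mul_I]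
  congr 1
  ring

lemma theta1_neg (τ : UpperHalfPlane) (z : ℂ) : theta1 τ (-z) = -theta1 τ z := by
  rw [theta1_eq_jacobiTheta₂, theta1_eq_jacobiTheta₂,
    show -z + 1 / 2 + (τ : ℂ) / 2 = -(z - 1 / 2 - τ / 2) by ring, jacobiTheta₂_neg_left,
    show z + 1 / 2 + (τ : ℂ) / 2 = (z - 1 / 2 - τ / 2) + 1 + τ by ring, jacobiTheta₂_add_left',
    jacobiTheta₂_add_left, ← mul_assoc, ← Complex.exp_add, ← neg_mul]
  congr 1
  rw [← Complex.exp_add_pi_mul_I]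
  congr 1
  ring

lemma theta1_zero (τ : UpperHalfPlane) : theta1 τ 0 = 0 := by
  have h := theta1_neg τ 0
  rw [neg_zero] at h
  exact self_eq_neg.mp h

/-! ### Calculus of theta functions of given degree and shift. -/

/-- Entire functions with the quasi-periodicity of a product of `n` factors `θ₁(z + aᵢ)` with
`∑ aᵢ = A`. -/
structure IsTheta (τ : UpperHalfPlane) (n : ℕ) (A : ℂ) (f : ℂ → ℂ) : Prop where
  diff : Differentiable ℂ f
  add_one : ∀ z, f (z + 1) = (-1) ^ n * f z
  add_tau : ∀ z, f (z + τ) =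
    (-1) ^ n * exp (-(Real.pi * I * (n * τ)) - 2 * Real.pi * I * (n * z + A)) * f z

namespace IsTheta

variable {τ : UpperHalfPlane} {n m : ℕ} {A B : ℂ} {f g : ℂ → ℂ}

lemma mul (hf : IsTheta τ n A f) (hg : IsTheta τ m B g) :
    IsTheta τ (n + m) (A + B) (fun z => f z * g z) where
  diff := hf.diff.mul hg.diff
  add_one z := by rw [hf.add_one, hg.add_one]; ring
  add_tau z := by
    rw [hf.add_tau, hg.add_tau,
      show -(Real.pi * I * ((n + m : ℕ) * (τ : ℂ))) - 2 * Real.pi * I * ((n + m : ℕ) * z + (A + B)) =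
        (-(Real.pi * I * (n * τ)) - 2 * Real.pi * I * (n * z + A)) +
        (-(Real.pi * I * (m * τ)) - 2 * Real.pi * I * (m * z + B)) by push_cast; ring,
      Complex.exp_add]
    ring

lemma add (hf : IsTheta τ n A f) (hg : IsTheta τ n A g) : IsTheta τ n A (fun z => f z + g z) where
  diff := hf.diff.add hg.diff
  add_one z := by rw [hf.add_one, hg.add_one]; ring
  add_tau z := by rw [hf.add_tau, hg.add_tau]; ring

lemma const_mul (c : ℂ) (hf : IsTheta τ n A f) : IsTheta τ n A (fun z => c * f z) where
  diff := hf.diff.const_mul c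
  add_one z := by rw [hf.add_one]; ring
  add_tau z := by rw [hf.add_tau]; ring

lemma sub (hf : IsTheta τ n A f) (hg : IsTheta τ n A g) : IsTheta τ n A (fun z => f z - g z) where
  diff := hf.diff.sub hg.diff
  add_one z := by rw [hf.add_one, hg.add_one]; ring
  add_tau z := by rw [hf.add_tau, hg.add_tau]; ring

lemma congr (hf : IsTheta τ n A f) (hn : n = m) (hA : A = B) : IsTheta τ m B f := hn ▸ hA ▸ hf

lemma comp_neg (hf : IsTheta τ n A f) : IsTheta τ n (-A) (fun z => f (-z)) where
  diff := hf.diff.comp differentiable_neg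
  add_one z := by
    have h := hf.add_one (-(z + 1))
    rw [show -(z + 1) + 1 = -z by ring] at h
    rw [h, ← mul_assoc, ← mul_pow]
    simp
  add_tau z := by
    have h := hf.add_tau (-(z + τ))
    rw [show -(z + (τ : ℂ)) + τ = -z by ring] at h
    have h1 : ((-1 : ℂ) ^ n) * (-1) ^ n = 1 := by rw [← mul_pow]; simp
    have h2 : exp (-(Real.pi * I * (n * τ)) - 2 * Real.pi * I * (n * z + -A)) *
        exp (-(Real.pi * I * (n * τ)) - 2 * Real.pi * I * (n * (-(z + τ)) + A)) = 1 := by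
      rw [← Complex.exp_add, Complex.exp_eq_one_iff]
      exact ⟨0, by push_cast; ring⟩
    rw [h]
    linear_combination (-f (-(z + τ))) *
      (exp (-(Real.pi * I * (n * τ)) - 2 * Real.pi * I * (n * z + -A)) *
        exp (-(Real.pi * I * (n * τ)) - 2 * Real.pi * I * (n * (-(z + τ)) + A)) * h1 + h2)

lemma one : IsTheta τ 0 0 (fun _ => 1) where
  diff := differentiable_const _
  add_one z := by simp
  add_tau z := by simp

lemma prod {ι : Type*} (s : Finset ι) (k : ℕ) {F : ι → ℂ → ℂ} (hF : ∀ i ∈ s, IsTheta τ k 0 (F i)) :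
    IsTheta τ (s.card * k) 0 (fun z => ∏ i ∈ s, F i z) := by
  classical
  induction s using Finset.induction_on with
  | empty => simpa using one
  | insert i s hi ih =>
    simp_rw [Finset.prod_insert hi]
    refine ((hF i (by simp)).mul (ih fun j hj => hF j (by simp [hj]))).congr ?_ (by simp)
    rw [Finset.card_insert_of_notMem hi]; ring

lemma theta1_add (τ : UpperHalfPlane) (a : ℂ) : IsTheta τ 1 a (fun z => theta1 τ (z + a)) where
  diff := (differentiable_theta1 τ).comp (by fun_prop)
  add_one z := by rw [add_right_comm, theta1_add_one]; ring
  add_tau z := by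
    rw [add_right_comm, theta1_add_tau]
    push_cast
    ring_nf

/-- Moving z by τ moves the argument by 2τ, so the multiplier of θ₁ enters twice: this gives degree
2² = 4 and shift 2a. -/
lemma theta1_two_mul_add (τ : UpperHalfPlane) (a : ℂ) :
    IsTheta τ 4 (2 * a) (fun z => theta1 τ (2 * z + a)) where
  diff := (differentiable_theta1 τ).comp (by fun_prop)
  add_one z := by
    rw [show 2 * (z + 1) + a = 2 * z + a + 1 + 1 by ring, theta1_add_one, theta1_add_one]; ring
  add_tau z := by
    rw [show 2 * (z + τ) + a = 2 * z + a + τ + τ by ring, theta1_add_tau, theta1_add_tau,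
      mul_neg, neg_neg, ← mul_assoc, ← Complex.exp_add,
      show (-1 : ℂ) ^ 4 = 1 by norm_num, one_mul]
    congr 2
    push_cast
    ring

end IsTheta

/-! ### Fourier coefficients of odd theta functions. -/

/-- The Fourier coefficients of a function of period `1`, along the real axis. -/
def coef (k : ℤ) (f : ℂ → ℂ) : ℂ := ∫ x in (0 : ℝ)..1, exp (-(2 * Real.pi * I * k * x)) * f x

/-- A real shift is absorbed by periodicity. An imaginary one follows from Cauchy's theorem on a
rectangle of width 1, whose vertical sides cancel. -/
lemma integral_add_of_periodic {g : ℂ → ℂ} (hg : Differentiable ℂ g) (hp : ∀ z, g (z + 1) = g z)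
    (w : ℂ) : ∫ x in (0 : ℝ)..1, g (x + w) = ∫ x in (0 : ℝ)..1, g x := by
  have h1 : ∫ x in (0 : ℝ)..1, g (x + w) = ∫ x in (0 : ℝ)..1, g (x + w.im * I) := by
    have hper : Function.Periodic (fun x : ℝ => g (x + w.im * I)) 1 := fun x => by
      simp only [ofReal_add, ofReal_one, add_right_comm _ (1 : ℂ), hp]
    have h2 := hper.intervalIntegral_add_eq w.re 0
    rw [zero_add] at h2
    have h3 := intervalIntegral.integral_comp_add_right (a := 0) (b := 1)
      (fun x : ℝ => g (x + w.im * I)) w.re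
    rw [zero_add, add_comm 1 w.re] at h3
    rw [← h2, ← h3]
    refine intervalIntegral.integral_congr fun x _ => ?_
    simp only [ofReal_add, add_assoc, re_add_im]
  have h2 := Complex.integral_boundary_rect_eq_zero_of_differentiableOn g 0 (1 + w.im * I)
    hg.differentiableOn
  have h3 : ∀ y : ℝ, g (1 + y * I) = g (y * I) := fun y => by rw [add_comm, hp]
  simp [h3] at h2
  rw [h1]
  exact (sub_eq_zero.mp h2).symm

/-- The Fourier series, being trivially summable, converges to f on the real line; the identity
theorem then extends the vanishing to ℂ. -/
lemma eq_zero_of_coef_eq_zero {f : ℂ → ℂ} (hf : Differentiable ℂ f) (hp : ∀ z, f (z + 1) = f z)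
    (h0 : ∀ k, coef k f = 0) : f = 0 := by
  have hper : Function.Periodic (fun x : ℝ => f x) 1 := fun x => by
    simp only [ofReal_add, ofReal_one, hp]
  have hc : Continuous fun x : ℝ => f x := hf.continuous.comp continuous_ofReal
  have hT : Fact ((0 : ℝ) < 1) := ⟨one_pos⟩
  let F : C(AddCircle (1 : ℝ), ℂ) := ⟨hper.lift, continuous_coinduced_dom.mpr hc⟩
  have hF : ∀ k, fourierCoeff F k = 0 := fun k => by
    rw [fourierCoeff_eq_intervalIntegral _ _ 0, zero_add, div_one, one_smul, ← h0 k, coef]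
    refine intervalIntegral.integral_congr fun x _ => ?_
    simp only [F, ContinuousMap.coe_mk, Function.Periodic.lift_coe, smul_eq_mul, fourier_coe_apply]
    congr 2
    push_cast
    ring
  have hreal : ∀ x : ℝ, f x = 0 := fun x => by
    have h1 := has_pointwise_sum_fourier_series_of_summable (f := F)
      (by simp only [funext hF]; exact summable_zero) (x : AddCircle (1 : ℝ))
    simp only [hF, zero_smul] at h1
    exact h1.unique hasSum_zero
  have ha : AnalyticOnNhd ℂ f Set.univ := hf.differentiableOn.analyticOnNhd isOpen_univ
  have := ha.eqOn_zero_of_preconnected_of_frequently_eq_zero isPreconnected_univ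
    (Set.mem_univ 0) ?_
  · exact funext fun z => this (Set.mem_univ z)
  · have hfr : ∃ᶠ x : ℝ in nhdsWithin 0 {0}ᶜ, f x = 0 :=
      (Filter.Eventually.of_forall hreal).frequently
    have ht : Filter.Tendsto (fun x : ℝ => (x : ℂ)) (nhdsWithin 0 {0}ᶜ) (nhdsWithin 0 {0}ᶜ) :=
      tendsto_nhdsWithin_iff.mpr ⟨by
        simpa using (continuous_ofReal.tendsto 0).mono_left nhdsWithin_le_nhds, by
        filter_upwards [self_mem_nhdsWithin] with x hx
        simpa using hx⟩
    exact ht.frequently hfr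

lemma intervalIntegrable_coef (k : ℤ) {f : ℂ → ℂ} (hf : Differentiable ℂ f) :
    IntervalIntegrable (fun x : ℝ => exp (-(2 * Real.pi * I * k * x)) * f x)
      MeasureTheory.volume 0 1 := by
  have := hf.continuous
  exact Continuous.intervalIntegrable (by fun_prop) _ _

lemma coef_neg_of_odd {f : ℂ → ℂ} (hp : ∀ z, f (z + 1) = f z)
    (ho : ∀ z, f (-z) = -f z) (k : ℤ) : coef (-k) f = -coef k f := by
  have hper : Function.Periodic (fun x : ℝ => exp (-(2 * Real.pi * I * k * x)) * f x) 1 := by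
    intro x
    simp only [ofReal_add, ofReal_one, hp]
    rw [show -(2 * Real.pi * I * k * ((x : ℂ) + 1)) =
      -(2 * Real.pi * I * k * x) + (-k : ℤ) * (2 * Real.pi * I) by push_cast; ring,
      Complex.exp_add, Complex.exp_int_mul_two_pi_mul_I, mul_one]
  have h2 := hper.intervalIntegral_add_eq (-1) 0
  rw [zero_add, neg_add_cancel] at h2
  rw [coef, coef, ← h2, ← intervalIntegral.integral_neg]
  have h3 := intervalIntegral.integral_comp_neg (a := 0) (b := 1)
    (fun x : ℝ => -(exp (-(2 * Real.pi * I * k * x)) * f x))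
  rw [neg_zero] at h3
  rw [← h3]
  refine intervalIntegral.integral_congr fun x _ => ?_
  simp only [ofReal_neg, ho, Int.cast_neg]
  ring_nf

/-- The contour is moved from ℝ to ℝ + τ, where the multiplier of f raises the frequency by n. Even
n makes f have period 1. -/
lemma IsTheta.coef_add {τ : UpperHalfPlane} {n : ℕ} {f : ℂ → ℂ} (hf : IsTheta τ n 0 f)
    (hn : Even n) (k : ℤ) :
    coef k f = exp (-(Real.pi * I * (n * τ)) - 2 * Real.pi * I * k * τ) * coef (k + n) f := by
  have hp : ∀ z, f (z + 1) = f z := fun z => by rw [hf.add_one, hn.neg_one_pow, one_mul]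
  have hd := hf.diff
  have h := integral_add_of_periodic (g := fun z => exp (-(2 * Real.pi * I * k * z)) * f z)
    (by fun_prop) (fun z => by
      rw [hp, show -(2 * Real.pi * I * k * (z + 1)) =
        -(2 * Real.pi * I * k * z) + (-k : ℤ) * (2 * Real.pi * I) by push_cast; ring,
        Complex.exp_add, Complex.exp_int_mul_two_pi_mul_I, mul_one]) τ
  rw [coef, ← h, coef, ← intervalIntegral.integral_const_mul]
  refine intervalIntegral.integral_congr fun x _ => ?_
  simp only [hf.add_tau, hn.neg_one_pow, one_mul]
  rw [← mul_assoc, ← mul_assoc (exp _) (exp _), ← Complex.exp_add, ← Complex.exp_add]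
  congr 2
  push_cast
  ring

lemma IsTheta.eq_zero_of_odd_of_coef {τ : UpperHalfPlane} {m : ℕ} {f : ℂ → ℂ}
    (hf : IsTheta τ (2 * m + 2) 0 f) (ho : ∀ z, f (-z) = -f z)
    (h0 : ∀ j : Fin m, coef (j + 1) f = 0) : f = 0 := by
  have he : Even (2 * m + 2) := ⟨m + 1, by ring⟩
  have hp : ∀ z, f (z + 1) = f z := fun z => by rw [hf.add_one, he.neg_one_pow, one_mul]
  have hneg := coef_neg_of_odd hp ho
  have hshift : ∀ k : ℤ, coef (k + (2 * m + 2 : ℕ)) f = 0 ↔ coef k f = 0 := fun k => by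
    rw [hf.coef_add he k]; simp [Complex.exp_ne_zero]
  have hshift' : ∀ q k : ℤ, coef (k + (2 * m + 2 : ℕ) * q) f = 0 ↔ coef k f = 0 := by
    intro q
    induction q using Int.induction_on with
    | zero => simp
    | succ i ih => intro k; rw [← ih k, ← hshift (k + _ * i)]; ring_nf
    | pred i ih => intro k; rw [← ih k, ← hshift (k + _ * (-i - 1))]; ring_nf
  have hsmall : ∀ r : ℕ, 1 ≤ r → r ≤ m → coef r f = 0 := fun r h1 h2 => by
    have := h0 ⟨r - 1, by omega⟩
    rwa [show (((⟨r - 1, by omega⟩ : Fin m) : ℕ) : ℤ) + 1 = r by simp; omega] at this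
  refine eq_zero_of_coef_eq_zero hf.diff hp fun k => ?_
  have hk := Int.emod_add_mul_ediv k (2 * m + 2 : ℕ)
  rw [← hk, hshift']
  obtain ⟨r, hr⟩ := Int.eq_ofNat_of_zero_le
    (Int.emod_nonneg k (show ((2 * m + 2 : ℕ) : ℤ) ≠ 0 by omega))
  have hlt := Int.emod_lt_of_pos k (show (0 : ℤ) < (2 * m + 2 : ℕ) by omega)
  rw [hr] at hlt ⊢
  rcases Nat.eq_zero_or_pos r with rfl | hpos
  · have := hneg 0
    simp only [neg_zero] at this
    exact self_eq_neg.mp this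
  rcases lt_trichotomy r (m + 1) with h | rfl | h
  · exact hsmall r hpos (by omega)
  -- The middle residue: between -(m+1) and m+1 the factor of `coef_add` is exactly 1, so the
  -- coefficient equals its own negative.
  · have h1 := hf.coef_add he (-((m : ℤ) + 1))
    rw [show -((m : ℤ) + 1) + (2 * m + 2 : ℕ) = (m : ℤ) + 1 by push_cast; ring, hneg,
      show -(Real.pi * I * ((2 * m + 2 : ℕ) * (τ : ℂ))) -
        2 * Real.pi * I * ((-((m : ℤ) + 1) : ℤ)) * τ = 0 by push_cast; ring,
      Complex.exp_zero, one_mul] at h1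
    push_cast
    exact neg_eq_self.mp h1
  · have h1 := hsmall (2 * m + 2 - r) (by omega) (by omega)
    rw [← neg_eq_zero, ← hneg, ← hshift, ← h1]
    congr 1
    omega

/-! ### Interpolation in the space of odd theta functions. -/

/-- The odd theta functions of degree `2 * m + 2`. -/
def oddTheta (τ : UpperHalfPlane) (m : ℕ) : Submodule ℂ (ℂ → ℂ) where
  carrier := {f | IsTheta τ (2 * m + 2) 0 f ∧ ∀ z, f (-z) = -f z}
  add_mem' hf hg := ⟨hf.1.add hg.1, fun z => by simp [hf.2 z, hg.2 z]; ring⟩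
  zero_mem' := ⟨⟨differentiable_const _, by simp, by simp⟩, by simp⟩
  smul_mem' c f hf := ⟨hf.1.const_mul c, fun z => by simp [hf.2 z]⟩

/-- The Fourier coefficients with indices `1, …, m`. -/
def oddThetaCoef (τ : UpperHalfPlane) (m : ℕ) : oddTheta τ m →ₗ[ℂ] (Fin m → ℂ) where
  toFun f j := coef (j + 1) f
  map_add' f g := by
    ext j
    simp only [coef, Submodule.coe_add, Pi.add_apply, mul_add]
    exact intervalIntegral.integral_add (intervalIntegrable_coef _ f.2.1.diff)
      (intervalIntegrable_coef _ g.2.1.diff)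
  map_smul' c f := by
    ext j
    simp only [coef, Submodule.coe_smul, Pi.smul_apply, smul_eq_mul, RingHom.id_apply,
      ← intervalIntegral.integral_const_mul]
    refine intervalIntegral.integral_congr fun x _ => ?_
    ring_nf

lemma oddThetaCoef_injective (τ : UpperHalfPlane) (m : ℕ) :
    Function.Injective (oddThetaCoef τ m) := by
  rw [← LinearMap.ker_eq_bot, LinearMap.ker_eq_bot']
  intro f hf
  exact Subtype.ext (f.2.1.eq_zero_of_odd_of_coef f.2.2 fun j => congrFun hf j)

/-- An odd theta function of degree `2 * m + 2` is determined by its values at `m` points in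
general position. -/
lemma IsTheta.eq_zero_of_odd {τ : UpperHalfPlane} {m : ℕ} {f : ℂ → ℂ}
    (hf : IsTheta τ (2 * m + 2) 0 f) (ho : ∀ z, f (-z) = -f z) (a : Fin m → ℂ)
    (ha : ∀ i, theta1 τ (2 * a i) ≠ 0)
    (hsub : ∀ i j, i ≠ j → theta1 τ (a i - a j) ≠ 0)
    (hadd : ∀ i j, i ≠ j → theta1 τ (a i + a j) ≠ 0)
    (h0 : ∀ i, f (a i) = 0) : f = 0 := by
  -- A Lagrange basis: the odd factor θ₁(2z) of degree 4 times m - 1 even factors of degree 2, in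
  -- total 2m + 2.
  let L : Fin m → ℂ → ℂ := fun i z => theta1 τ (2 * z + 0) *
    ∏ j ∈ Finset.univ.erase i, theta1 τ (z + -a j) * theta1 τ (z + a j)
  have hL : ∀ i, L i ∈ oddTheta τ m := fun i => by
    refine ⟨((IsTheta.theta1_two_mul_add τ 0).mul (IsTheta.prod _ 2 fun j _ =>
      ((IsTheta.theta1_add τ (-a j)).mul (IsTheta.theta1_add τ (a j))).congr rfl
        (by ring))).congr ?_ (by ring), fun z => ?_⟩
    · rw [Finset.card_erase_of_mem (Finset.mem_univ i), Finset.card_univ, Fintype.card_fin]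
      have := i.pos
      omega
    · simp only [L, add_zero, mul_neg, theta1_neg, neg_mul, neg_inj]
      congr 1
      refine Finset.prod_congr rfl fun j _ => ?_
      rw [show -z + -a j = -(z + a j) by ring, show -z + a j = -(z + -a j) by ring, theta1_neg,
        theta1_neg]
      ring
  have hLself : ∀ i, L i (a i) ≠ 0 := fun i => by
    simp only [L, add_zero]
    refine mul_ne_zero (ha i) (Finset.prod_ne_zero_iff.mpr fun j hj => ?_)
    have hij : i ≠ j := (Finset.ne_of_mem_erase hj).symm
    exact mul_ne_zero (by simpa [sub_eq_add_neg] using hsub i j hij) (hadd i j hij)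
  have hLne : ∀ i j, i ≠ j → L i (a j) = 0 := fun i j hij => by
    refine mul_eq_zero_of_right _ (Finset.prod_eq_zero (i := j) (by simp [hij.symm]) ?_)
    rw [add_neg_cancel, theta1_zero, zero_mul]
  let ev : oddTheta τ m →ₗ[ℂ] (Fin m → ℂ) :=
    { toFun := fun g i => (g : ℂ → ℂ) (a i)
      map_add' := fun _ _ => rfl
      map_smul' := fun _ _ => rfl }
  have hsurj : Function.Surjective ev := fun v => by
    refine ⟨∑ i, (v i / L i (a i)) • ⟨L i, hL i⟩, ?_⟩
    rw [map_sum]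
    ext j
    rw [Finset.sum_apply, Finset.sum_eq_single j]
    · simp [ev, hLself]
    · intro i _ hij
      simp [ev, hLne i j hij]
    · simp
  have hfin : Module.Finite ℂ (oddTheta τ m) :=
    Module.Finite.of_injective _ (oddThetaCoef_injective τ m)
  -- The coefficients bound the dimension above by m and the evaluations bound it below, so the
  -- surjective `ev` is also injective.
  have hle := LinearMap.finrank_le_finrank_of_injective (oddThetaCoef_injective τ m)
  have hge := LinearMap.finrank_le_finrank_of_surjective hsurj
  have hinj := (LinearMap.injective_iff_surjective_of_finrank_eq_finrank
    (le_antisymm hle hge)).mpr hsurj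
  have : (⟨f, hf, ho⟩ : oddTheta τ m) = 0 := hinj (by
    ext i
    simpa [ev] using h0 i)
  exact congrArg Subtype.val this

end C2Theta
end

/-! ### The sum over signs as a quotient of odd theta functions. -/

noncomputable section
namespace C2Theta
open Complex

variable {τ : UpperHalfPlane} {h x y z : ℂ}

lemma theta1_ne_zero_of_eq_neg {a b : ℂ} (ha : theta1 τ a ≠ 0) (hb : b = -a) :
    theta1 τ b ≠ 0 := by
  rw [hb, theta1_neg]
  exact neg_ne_zero.mpr ha

lemma IsTheta.theta1_two_mul (τ : UpperHalfPlane) : IsTheta τ 4 0 (fun z => theta1 τ (2 * z)) := by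
  simpa using IsTheta.theta1_two_mul_add τ 0

/-- The function in the second sum of the identity, at `s = λ_{p+q}`. -/
def V (τ : UpperHalfPlane) (h s : ℂ) : ℂ :=
  (theta1 τ (s - h) * theta1 τ (s + 2 * h)) / (theta1 τ s * theta1 τ (s + h))

/-- The sum over signs, as a function of `x = λ_{ε₁}` and `y = λ_{ε₂}`. -/
def signSum (τ : UpperHalfPlane) (h x y : ℂ) : ℂ :=
  (U τ h x y - V τ h (x + y)) + (U τ h x (-y) - V τ h (x + -y)) +
    (U τ h (-x) y - V τ h (-x + y)) + (U τ h (-x) (-y) - V τ h (-x + -y))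

/-- A common denominator, in the variable `x`, of the terms of `signSum`. -/
def den (τ : UpperHalfPlane) (h y x : ℂ) : ℂ :=
  theta1 τ (2 * x) * ((theta1 τ (x + y) * theta1 τ (x + (y + h)) * theta1 τ (x + (y - h))) *
    (theta1 τ (x + -y) * theta1 τ (x + (-y + h)) * theta1 τ (x + (-y - h))))

/-- The factor of `U` that depends on `y` and `h` only. -/
def coeffU (τ : UpperHalfPlane) (h y : ℂ) : ℂ :=
  theta1 τ (2 * h) / theta1 τ (6 * h) * (theta1 τ (2 * y + 2 * h) / theta1 τ (2 * y))

/-- The numerator of one term of `signSum` over the denominator `den`. -/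
def numTerm (τ : UpperHalfPlane) (h y x : ℂ) : ℂ :=
  (coeffU τ h y * (theta1 τ (2 * x + 2 * h) * theta1 τ (x + (y - 5 * h))) -
      theta1 τ (2 * x) * theta1 τ (x + (y - h))) *
    ((theta1 τ (x + (y + 2 * h)) * theta1 τ (x + (y - h))) *
      (theta1 τ (x + -y) * theta1 τ (x + (-y + h)) * theta1 τ (x + (-y - h))))

/-- The numerator of `signSum` over the denominator `den`. -/
def num (τ : UpperHalfPlane) (h y x : ℂ) : ℂ :=
  (numTerm τ h y x + numTerm τ h (-y) x) - (numTerm τ h y (-x) + numTerm τ h (-y) (-x))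

lemma den_neg_left (τ : UpperHalfPlane) (h y x : ℂ) : den τ h (-y) x = den τ h y x := by
  simp only [den, neg_neg]
  ring

lemma den_neg_right (τ : UpperHalfPlane) (h y x : ℂ) : den τ h y (-x) = -den τ h y x := by
  simp only [den]
  rw [show 2 * -x = -(2 * x) by ring, show -x + y = -(x + -y) by ring,
    show -x + (y + h) = -(x + (-y - h)) by ring, show -x + (y - h) = -(x + (-y + h)) by ring,
    show -x + -y = -(x + y) by ring, show -x + (-y + h) = -(x + (y - h)) by ring,
    show -x + (-y - h) = -(x + (y + h)) by ring]
  simp only [theta1_neg]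
  ring

lemma num_neg_right (τ : UpperHalfPlane) (h y x : ℂ) : num τ h y (-x) = -num τ h y x := by
  simp only [num, neg_neg]
  ring

lemma mul_den_eq_numTerm (hd : den τ h y x ≠ 0) :
    (U τ h x y - V τ h (x + y)) * den τ h y x = numTerm τ h y x := by
  simp only [den, mul_ne_zero_iff] at hd
  obtain ⟨h2, ⟨⟨h3, h4⟩, -⟩, -⟩ := hd
  simp only [U, V, den, numTerm, coeffU, ← add_assoc, ← add_sub_assoc] at h4 ⊢
  -- Both quotients inside `coeffU` stay opaque, so θ₁(6h) and θ₁(2y) need not be nonzero here.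
  generalize theta1 τ (2 * h) / theta1 τ (6 * h) = c
  rw [mul_div_mul_comm]
  generalize theta1 τ (2 * y + 2 * h) / theta1 τ (2 * y) = g
  field_simp

lemma signSum_mul_den (hd : den τ h y x ≠ 0) : signSum τ h x y * den τ h y x = num τ h y x := by
  have hd' : den τ h y (-x) ≠ 0 := by rw [den_neg_right]; exact neg_ne_zero.mpr hd
  have h1 := mul_den_eq_numTerm hd
  have h2 := mul_den_eq_numTerm (y := -y) (x := x) (by rw [den_neg_left]; exact hd)
  have h3 := mul_den_eq_numTerm hd'
  have h4 := mul_den_eq_numTerm (y := -y) (x := -x) (by rw [den_neg_left]; exact hd')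
  rw [den_neg_right] at h3
  rw [den_neg_left, den_neg_right] at h4
  rw [den_neg_left] at h2
  rw [signSum, num, ← h1, ← h2, ← h3, ← h4]
  ring

lemma isTheta_den (τ : UpperHalfPlane) (h y : ℂ) : IsTheta τ 10 0 (den τ h y) := by
  have T := IsTheta.theta1_add τ
  exact ((IsTheta.theta1_two_mul τ).mul ((((T y).mul (T (y + h))).mul (T (y - h))).mul
    (((T (-y)).mul (T (-y + h))).mul (T (-y - h))))).congr rfl (by ring)

lemma isTheta_numTerm (τ : UpperHalfPlane) (h y : ℂ) : IsTheta τ 10 0 (numTerm τ h y) := by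
  have T := IsTheta.theta1_add τ
  -- The two summands have equal shifts, 4h + (y - 5h) = 0 + (y - h); the 5h in `U` is what makes
  -- them match.
  have h1 : IsTheta τ 5 (y - h) _ := (((IsTheta.theta1_two_mul_add τ (2 * h)).mul
    (T (y - 5 * h))).const_mul (coeffU τ h y)).congr rfl (by ring)
  have h2 : IsTheta τ 5 (y - h) _ := ((IsTheta.theta1_two_mul τ).mul (T (y - h))).congr rfl (by ring)
  exact ((h1.sub h2).mul (((T (y + 2 * h)).mul (T (y - h))).mul
    (((T (-y)).mul (T (-y + h))).mul (T (-y - h))))).congr rfl (by ring)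

lemma isTheta_num (τ : UpperHalfPlane) (h y : ℂ) : IsTheta τ 10 0 (num τ h y) := by
  have h1 := (isTheta_numTerm τ h y).add (isTheta_numTerm τ h (-y))
  exact h1.sub (h1.comp_neg.congr rfl neg_zero)

/-- The factor outside the bracket of `numTerm` vanishes at y, y + h, y - h and -y + h, which gives
this lemma and the next three. -/
lemma numTerm_self (τ : UpperHalfPlane) (h y : ℂ) : numTerm τ h y y = 0 := by
  simp [numTerm, theta1_zero]

lemma numTerm_add (τ : UpperHalfPlane) (h y : ℂ) : numTerm τ h y (y + h) = 0 := by
  simp [numTerm, theta1_zero, show y + h + (-y - h) = 0 by ring]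

lemma numTerm_sub (τ : UpperHalfPlane) (h y : ℂ) : numTerm τ h y (y - h) = 0 := by
  simp [numTerm, theta1_zero, show y - h + (-y + h) = 0 by ring]

lemma numTerm_neg_add (τ : UpperHalfPlane) (h y : ℂ) : numTerm τ h y (-y + h) = 0 := by
  simp [numTerm, theta1_zero, show -y + h + (y - h) = 0 by ring]

/-- At x + y = -h the poles of `U` and `V` cancel within a single term: the quotients in 2x and 2y
multiply to 1, and the prefactor θ₁(2h)/θ₁(6h) turns θ₁(-6h) into θ₁(-2h). -/
lemma numTerm_neg_sub (h6 : theta1 τ (6 * h) ≠ 0) (hy : theta1 τ (2 * y) ≠ 0) :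
    numTerm τ h y (-y - h) = 0 := by
  rw [numTerm, coeffU, show 2 * (-y - h) + 2 * h = -(2 * y) by ring,
    show -y - h + (y - 5 * h) = -(6 * h) by ring, show 2 * (-y - h) = -(2 * y + 2 * h) by ring,
    show -y - h + (y - h) = -(2 * h) by ring]
  simp only [theta1_neg]
  refine mul_eq_zero_of_left ?_ _
  generalize theta1 τ (6 * h) = a at h6 ⊢
  generalize theta1 τ (2 * y) = b at hy ⊢
  field_simp
  ring

/-- The pole at x = y occurs in the terms with signs (+, -) and (-, +), whose residues are opposite.
-/
lemma num_self (hy : theta1 τ (2 * y) ≠ 0) : num τ h y y = 0 := by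
  have h1 : numTerm τ h (-y) y = numTerm τ h y (-y) := by
    simp only [numTerm, coeffU, neg_neg]
    rw [show 2 * -y + 2 * h = -(2 * y - 2 * h) by ring, show 2 * -y = -(2 * y) by ring,
      show y + (-y - 5 * h) = -(5 * h) by ring, show y + (-y - h) = -h by ring,
      show y + (-y + 2 * h) = 2 * h by ring, show -y + (y - 5 * h) = -(5 * h) by ring,
      show -y + (y - h) = -h by ring, show -y + (y + 2 * h) = 2 * h by ring,
      show -y + -y = -(y + y) by ring, show -y + (-y + h) = -(y + (y - h)) by ring,
      show -y + (-y - h) = -(y + (y + h)) by ring]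
    simp only [theta1_neg]
    generalize theta1 τ (2 * h) / theta1 τ (6 * h) = c
    field_simp
    ring
  rw [num, numTerm_self, numTerm_self, h1]
  ring

lemma num_add (h6 : theta1 τ (6 * h) ≠ 0) (hy : theta1 τ (2 * y) ≠ 0) : num τ h y (y + h) = 0 := by
  have h1 := numTerm_add τ h y
  have h2 := numTerm_neg_add τ h (-y)
  have h3 := numTerm_neg_sub h6 hy
  have h4 := numTerm_sub τ h (-y)
  rw [neg_neg] at h2
  rw [num, h1, h2, show -(y + h) = -y - h by ring, h3, h4]
  ring

lemma num_sub (h6 : theta1 τ (6 * h) ≠ 0) (hy : theta1 τ (2 * y) ≠ 0) : num τ h y (y - h) = 0 := by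
  have h1 := numTerm_sub τ h y
  have h2 := numTerm_neg_sub (y := -y) h6
    (theta1_ne_zero_of_eq_neg hy (by ring))
  have h3 := numTerm_neg_add τ h y
  have h4 := numTerm_add τ h (-y)
  rw [neg_neg] at h2
  rw [num, h1, h2, show -(y - h) = -y + h by ring, h3, h4]
  ring

/-- The sum over signs does not depend on `x`. -/
lemma signSum_eq_signSum {x' : ℂ} (h1 : theta1 τ h ≠ 0) (h2 : theta1 τ (2 * h) ≠ 0)
    (h6 : theta1 τ (6 * h) ≠ 0) (hy : theta1 τ (2 * y) ≠ 0)
    (hy1 : theta1 τ (2 * y + h) ≠ 0) (hy2 : theta1 τ (2 * y - h) ≠ 0)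
    (hy3 : theta1 τ (2 * y + 2 * h) ≠ 0) (hy4 : theta1 τ (2 * y - 2 * h) ≠ 0)
    (hx : den τ h y x ≠ 0) (hx' : den τ h y x' ≠ 0) :
    signSum τ h x y = signSum τ h x' y := by
  have hf : IsTheta τ 10 0 (fun z => den τ h y x' * num τ h y z - num τ h y x' * den τ h y z) :=
    ((isTheta_num τ h y).const_mul _).sub ((isTheta_den τ h y).const_mul _)
  have hd0 : den τ h y y = 0 := by simp [den, theta1_zero]
  have hd1 : den τ h y (y + h) = 0 := by
    simp [den, theta1_zero, show y + h + (-y - h) = 0 by ring]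
  have hd2 : den τ h y (y - h) = 0 := by
    simp [den, theta1_zero, show y - h + (-y + h) = 0 by ring]
  have hne := hx'
  simp only [den, mul_ne_zero_iff] at hne
  obtain ⟨e1, ⟨⟨e2, e3⟩, e4⟩, ⟨e5, e6⟩, e7⟩ := hne
  -- Degree 10 = 2 · 4 + 2, so four zeros are needed: the three removable poles, and x', where the
  -- combination vanishes by construction.
  have key := hf.eq_zero_of_odd (m := 4)
    (fun z => by rw [num_neg_right, den_neg_right]; ring) ![y, y + h, y - h, x']
    (by
      intro i
      fin_cases i
      · exact hy
      · simpa [mul_add] using hy3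
      · simpa [mul_sub] using hy4
      · exact e1)
    (by
      have hlt : ∀ i j, i < j →
          theta1 τ (![y, y + h, y - h, x'] i - ![y, y + h, y - h, x'] j) ≠ 0 := by
        intro i j hij
        fin_cases i <;> fin_cases j <;> first
          | exact absurd hij (by decide)
          | skip
        · exact theta1_ne_zero_of_eq_neg h1 (by simp)
        · simpa using h1
        · exact theta1_ne_zero_of_eq_neg e5 (by simp; ring)
        · simpa [show y + h - (y - h) = 2 * h by ring] using h2
        · exact theta1_ne_zero_of_eq_neg e7 (by simp; ring)
        · exact theta1_ne_zero_of_eq_neg e6 (by simp; ring)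
      intro i j hij
      rcases lt_or_gt_of_ne hij with hij | hij
      · exact hlt i j hij
      · exact theta1_ne_zero_of_eq_neg (hlt j i hij) (by ring))
    (by
      have hlt : ∀ i j, i < j →
          theta1 τ (![y, y + h, y - h, x'] i + ![y, y + h, y - h, x'] j) ≠ 0 := by
        intro i j hij
        fin_cases i <;> fin_cases j <;> first
          | exact absurd hij (by decide)
          | skip
        · simpa [show y + (y + h) = 2 * y + h by ring] using hy1
        · simpa [show y + (y - h) = 2 * y - h by ring] using hy2
        · simpa [add_comm] using e2
        · simpa [show y + h + (y - h) = 2 * y by ring] using hy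
        · simpa [show y + h + x' = x' + (y + h) by ring] using e3
        · simpa [show y - h + x' = x' + (y - h) by ring] using e4
      intro i j hij
      rcases lt_or_gt_of_ne hij with hij | hij
      · exact hlt i j hij
      · rw [add_comm]
        exact hlt j i hij)
    (by
      intro i
      fin_cases i
      · simp [num_self hy, hd0]
      · simp [num_add h6 hy, hd1]
      · simp [num_sub h6 hy, hd2]
      · simp [mul_comm])
  have h0 := congrFun key x
  simp only [Pi.zero_apply, ← signSum_mul_den hx, ← signSum_mul_den hx'] at h0
  refine mul_left_cancel₀ (mul_ne_zero hx' hx) ?_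
  linear_combination h0

/-! ### Symmetry and the value of the constant. -/

lemma U_comm (τ : UpperHalfPlane) (h x y : ℂ) : U τ h x y = U τ h y x := by
  rw [U, U, add_comm y x, mul_comm (theta1 τ (2 * y + 2 * h)), mul_comm (theta1 τ (2 * y))]

lemma signSum_comm (τ : UpperHalfPlane) (h x y : ℂ) : signSum τ h x y = signSum τ h y x := by
  rw [signSum, signSum, U_comm τ h x y, U_comm τ h x (-y), U_comm τ h (-x) y,
    U_comm τ h (-x) (-y), add_comm x y, add_comm x (-y), add_comm (-x) y, add_comm (-x) (-y)]
  ring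

/-- At this point θ₁(2x + 2h) = 0 kills both `U` terms with first argument -h, and θ₁(λ_{p+q} + 2h)
= 0 kills `U` and `V` at (h, -3h). What survives is `U` at (h, 3h) and `V` at -4h, 4h, 2h: the four
terms of K. -/
lemma signSum_eq_K (h1 : theta1 τ h ≠ 0) (h2 : theta1 τ (2 * h) ≠ 0) (h3 : theta1 τ (3 * h) ≠ 0)
    (h4 : theta1 τ (4 * h) ≠ 0) (h5 : theta1 τ (5 * h) ≠ 0) (h6 : theta1 τ (6 * h) ≠ 0) :
    signSum τ h (-h) (-(3 * h)) = K τ h := by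
  simp only [signSum, U, V, K, neg_neg]
  rw [show 2 * -h + 2 * h = 0 by ring, show 2 * h + 2 * h = 4 * h by ring,
    show 2 * -h = -(2 * h) by ring, show 2 * -(3 * h) + 2 * h = -(4 * h) by ring,
    show 2 * -(3 * h) = -(6 * h) by ring, show 2 * (3 * h) + 2 * h = 8 * h by ring,
    show 2 * (3 * h) = 6 * h by ring, show -h + -(3 * h) - 5 * h = -(9 * h) by ring,
    show -h + -(3 * h) + 2 * h = -(2 * h) by ring, show -h + -(3 * h) + h = -(3 * h) by ring,
    show -h + -(3 * h) - h = -(5 * h) by ring, show -h + -(3 * h) = -(4 * h) by ring,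
    show -h + 3 * h - 5 * h = -(3 * h) by ring, show -h + 3 * h + 2 * h = 4 * h by ring,
    show -h + 3 * h + h = 3 * h by ring, show -h + 3 * h - h = h by ring,
    show -h + 3 * h = 2 * h by ring, show h + -(3 * h) - 5 * h = -(7 * h) by ring,
    show h + -(3 * h) + 2 * h = 0 by ring, show h + -(3 * h) + h = -h by ring,
    show h + -(3 * h) - h = -(3 * h) by ring, show h + -(3 * h) = -(2 * h) by ring,
    show h + 3 * h - 5 * h = -h by ring, show h + 3 * h + 2 * h = 6 * h by ring,
    show h + 3 * h + h = 5 * h by ring, show h + 3 * h - h = 3 * h by ring,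
    show h + 3 * h = 4 * h by ring]
  simp only [theta1_neg, theta1_zero]
  generalize theta1 τ h = t1 at h1 ⊢
  generalize theta1 τ (2 * h) = t2 at h2 ⊢
  generalize theta1 τ (3 * h) = t3 at h3 ⊢
  generalize theta1 τ (4 * h) = t4 at h4 ⊢
  generalize theta1 τ (5 * h) = t5 at h5 ⊢
  generalize theta1 τ (6 * h) = t6 at h6 ⊢
  field_simp
  ring

end C2Theta
end

/-! ### Generic parameters and passage to the limit. -/

noncomputable section
namespace C2Theta
open Complex

/-- No combination of `h, x, y` with small integer coefficients is a zero of `θ₁`. -/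
def Generic (τ : UpperHalfPlane) (h x y : ℂ) : Prop :=
  ∀ a ∈ Finset.Icc (-8 : ℤ) 8, ∀ b ∈ Finset.Icc (-2 : ℤ) 2, ∀ c ∈ Finset.Icc (-2 : ℤ) 2,
    ¬(a = 0 ∧ b = 0 ∧ c = 0) → theta1 τ (a * h + b * x + c * y) ≠ 0

variable {τ : UpperHalfPlane} {h x y z : ℂ}

lemma Generic.ne_zero (hg : Generic τ h x y) (a b c : ℤ) (ha : |a| ≤ 8) (hb : |b| ≤ 2)
    (hc : |c| ≤ 2) (h0 : ¬(a = 0 ∧ b = 0 ∧ c = 0)) (hz : z = a * h + b * x + c * y) :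
    theta1 τ z ≠ 0 :=
  hz ▸ hg a (Finset.mem_Icc.mpr (abs_le.mp ha)) b (Finset.mem_Icc.mpr (abs_le.mp hb)) c
    (Finset.mem_Icc.mpr (abs_le.mp hc)) h0

lemma Generic.signSum_eq_K (hg : Generic τ h x y) : signSum τ h x y = K τ h := by
  have G : ∀ (z : ℂ) (a b c : ℤ), |a| ≤ 8 → |b| ≤ 2 → |c| ≤ 2 → ¬(a = 0 ∧ b = 0 ∧ c = 0) →
      z = a * h + b * x + c * y → theta1 τ z ≠ 0 := fun z => hg.ne_zero
  have H : ∀ (z : ℂ) (a : ℤ), |a| ≤ 8 → a ≠ 0 → z = a * h → theta1 τ z ≠ 0 := fun z a h1 h2 h3 =>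
    G z a 0 0 h1 (by decide) (by decide) (fun h => h2 h.1) (by rw [h3]; simp)
  have h1 := H h 1 (by decide) (by decide) (by simp)
  have h2 := H (2 * h) 2 (by decide) (by decide) (by simp)
  have h6 := H (6 * h) 6 (by decide) (by decide) (by simp)
  -- The path is (x, y) to (-3h, y), swapped to (y, -3h), then to (-h, -3h); no `den` met on it
  -- vanishes.
  rw [signSum_eq_signSum (x := x) (x' := -(3 * h)) h1 h2 h6, signSum_comm,
    signSum_eq_signSum (x := y) (x' := -h) h1 h2 h6,
    C2Theta.signSum_eq_K h1 h2 (H _ 3 (by decide) (by decide) (by simp))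
      (H _ 4 (by decide) (by decide) (by simp)) (H _ 5 (by decide) (by decide) (by simp)) h6]
  · exact H _ (-6) (by decide) (by decide) (by push_cast; ring)
  · exact H _ (-5) (by decide) (by decide) (by push_cast; ring)
  · exact H _ (-7) (by decide) (by decide) (by push_cast; ring)
  · exact H _ (-4) (by decide) (by decide) (by push_cast; ring)
  · exact H _ (-8) (by decide) (by decide) (by push_cast; ring)
  · simp only [den, mul_ne_zero_iff]
    refine ⟨G _ 0 0 2 ?_ ?_ ?_ ?_ ?_, ⟨⟨G _ (-3) 0 1 ?_ ?_ ?_ ?_ ?_, G _ (-2) 0 1 ?_ ?_ ?_ ?_ ?_⟩,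
      G _ (-4) 0 1 ?_ ?_ ?_ ?_ ?_⟩, ⟨G _ 3 0 1 ?_ ?_ ?_ ?_ ?_, G _ 4 0 1 ?_ ?_ ?_ ?_ ?_⟩,
      G _ 2 0 1 ?_ ?_ ?_ ?_ ?_⟩ <;> first | decide | (push_cast; ring)
  · simp only [den, mul_ne_zero_iff]
    refine ⟨H _ (-2) ?_ ?_ ?_, ⟨⟨H _ (-4) ?_ ?_ ?_, H _ (-3) ?_ ?_ ?_⟩, H _ (-5) ?_ ?_ ?_⟩,
      ⟨H _ 2 ?_ ?_ ?_, H _ 3 ?_ ?_ ?_⟩, H _ 1 ?_ ?_ ?_⟩ <;> first | decide | (push_cast; ring)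
  · refine G _ 0 0 2 ?_ ?_ ?_ ?_ ?_ <;> first | decide | (push_cast; ring)
  · refine G _ 1 0 2 ?_ ?_ ?_ ?_ ?_ <;> first | decide | (push_cast; ring)
  · refine G _ (-1) 0 2 ?_ ?_ ?_ ?_ ?_ <;> first | decide | (push_cast; ring)
  · refine G _ 2 0 2 ?_ ?_ ?_ ?_ ?_ <;> first | decide | (push_cast; ring)
  · refine G _ (-2) 0 2 ?_ ?_ ?_ ?_ ?_ <;> first | decide | (push_cast; ring)
  · simp only [den, mul_ne_zero_iff]
    refine ⟨G _ 0 2 0 ?_ ?_ ?_ ?_ ?_, ⟨⟨G _ 0 1 1 ?_ ?_ ?_ ?_ ?_, G _ 1 1 1 ?_ ?_ ?_ ?_ ?_⟩,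
      G _ (-1) 1 1 ?_ ?_ ?_ ?_ ?_⟩, ⟨G _ 0 1 (-1) ?_ ?_ ?_ ?_ ?_, G _ 1 1 (-1) ?_ ?_ ?_ ?_ ?_⟩,
      G _ (-1) 1 (-1) ?_ ?_ ?_ ?_ ?_⟩ <;> first | decide | (push_cast; ring)
  · simp only [den, mul_ne_zero_iff]
    refine ⟨H _ (-6) ?_ ?_ ?_, ⟨⟨G _ (-3) 0 1 ?_ ?_ ?_ ?_ ?_, G _ (-2) 0 1 ?_ ?_ ?_ ?_ ?_⟩,
      G _ (-4) 0 1 ?_ ?_ ?_ ?_ ?_⟩, ⟨G _ (-3) 0 (-1) ?_ ?_ ?_ ?_ ?_,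
      G _ (-2) 0 (-1) ?_ ?_ ?_ ?_ ?_⟩, G _ (-4) 0 (-1) ?_ ?_ ?_ ?_ ?_⟩ <;>
      first | decide | (push_cast; ring)

lemma eventually_theta1_ne_zero {w : ℂ} (hw : theta1 τ w ≠ 0) (u : ℂ) {k : ℂ} (hk : k ≠ 0) :
    ∀ᶠ t in nhdsWithin (0 : ℂ) {0}ᶜ, theta1 τ (u + k * t) ≠ 0 := by
  have hd : Differentiable ℂ fun t => theta1 τ (u + k * t) :=
    (differentiable_theta1 τ).comp (by fun_prop)
  have ha : AnalyticOnNhd ℂ (fun t => theta1 τ (u + k * t)) Set.univ :=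
    hd.differentiableOn.analyticOnNhd isOpen_univ
  by_contra hcon
  have h0 := ha.eqOn_zero_of_preconnected_of_frequently_eq_zero isPreconnected_univ
    (Set.mem_univ 0) (by simpa [Filter.not_eventually] using hcon)
  -- Otherwise θ₁ would vanish identically, as k ≠ 0 lets the argument reach w.
  refine hw ?_
  have := h0 (Set.mem_univ ((w - u) / k))
  simpa [mul_div_cancel₀ _ hk] using this

lemma eventually_generic {w : ℂ} (hw : theta1 τ w ≠ 0) (h x y : ℂ) :
    ∀ᶠ t in nhdsWithin (0 : ℂ) {0}ᶜ, Generic τ (h + t) (x + 100 * t) (y + 10000 * t) := by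
  simp only [Generic]
  refine (Filter.eventually_all_finset _).mpr fun a ha =>
    (Filter.eventually_all_finset _).mpr fun b hb =>
    (Filter.eventually_all_finset _).mpr fun c hc => ?_
  rw [Finset.mem_Icc] at ha hb hc
  by_cases h0 : a = 0 ∧ b = 0 ∧ c = 0
  · simp [h0]
  -- The weights 1, 100, 10000 are so far apart that no nonzero triple within the bounds cancels:
  -- the perturbation moves every linear form in `Generic`.
  have hk : ((a + 100 * b + 10000 * c : ℤ) : ℂ) ≠ 0 := by
    rw [Int.cast_ne_zero]
    omega
  filter_upwards [eventually_theta1_ne_zero hw (a * h + b * x + c * y) hk] with t ht _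
  convert ht using 2
  push_cast
  ring

lemma continuousAt_U {f g k : ℂ → ℂ} {t : ℂ} (hf : Continuous f) (hg : Continuous g)
    (hk : Continuous k) (h6 : theta1 τ (6 * f t) ≠ 0) (h1 : theta1 τ (2 * g t) ≠ 0)
    (h2 : theta1 τ (2 * k t) ≠ 0) (h3 : theta1 τ (g t + k t) ≠ 0)
    (h4 : theta1 τ (g t + k t + f t) ≠ 0) : ContinuousAt (fun s => U τ (f s) (g s) (k s)) t := by
  have hT : Continuous (theta1 τ) := (differentiable_theta1 τ).continuous
  have h5 := mul_ne_zero h1 h2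
  have h7 := mul_ne_zero h3 h4
  unfold U
  fun_prop (disch := assumption)

lemma continuousAt_V {f g : ℂ → ℂ} {t : ℂ} (hf : Continuous f) (hg : Continuous g)
    (h3 : theta1 τ (g t) ≠ 0) (h4 : theta1 τ (g t + f t) ≠ 0) :
    ContinuousAt (fun s => V τ (f s) (g s)) t := by
  have hT : Continuous (theta1 τ) := (differentiable_theta1 τ).continuous
  have h5 := mul_ne_zero h3 h4
  unfold V
  fun_prop (disch := assumption)

lemma continuousAt_K {f : ℂ → ℂ} {t : ℂ} (hf : Continuous f)
    (h2 : theta1 τ (2 * f t) ≠ 0) (h3 : theta1 τ (3 * f t) ≠ 0) (h4 : theta1 τ (4 * f t) ≠ 0)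
    (h5 : theta1 τ (5 * f t) ≠ 0) (h6 : theta1 τ (6 * f t) ≠ 0) :
    ContinuousAt (fun s => K τ (f s)) t := by
  have hT : Continuous (theta1 τ) := (differentiable_theta1 τ).continuous
  have e1 := mul_ne_zero h6 h5
  have e2 := mul_ne_zero h4 h3
  have e3 := mul_ne_zero h5 h4
  have e4 := mul_ne_zero h3 h2
  unfold K
  fun_prop (disch := assumption)

/-- The identity in the coordinates `x = λ_{ε₁}`, `y = λ_{ε₂}`. -/
lemma signSum_eq_K_of_ne_zero (h2 : theta1 τ (2 * h) ≠ 0) (h3 : theta1 τ (3 * h) ≠ 0)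
    (h4 : theta1 τ (4 * h) ≠ 0) (h5 : theta1 τ (5 * h) ≠ 0) (h6 : theta1 τ (6 * h) ≠ 0)
    (hxy : ∀ u ∈ ({x, -x} : Finset ℂ), ∀ v ∈ ({y, -y} : Finset ℂ), theta1 τ (2 * u) ≠ 0 ∧
      theta1 τ (2 * v) ≠ 0 ∧ theta1 τ (u + v) ≠ 0 ∧ theta1 τ (u + v + h) ≠ 0) :
    signSum τ h x y = K τ h := by
  have hterm : ∀ g k : ℂ → ℂ, Continuous g → Continuous k →
      (theta1 τ (2 * g 0) ≠ 0 ∧ theta1 τ (2 * k 0) ≠ 0 ∧ theta1 τ (g 0 + k 0) ≠ 0 ∧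
        theta1 τ (g 0 + k 0 + h) ≠ 0) →
      ContinuousAt (fun t => U τ (h + t) (g t) (k t) - V τ (h + t) (g t + k t)) 0 := by
    intro g k hg hk ⟨e1, e2, e3, e4⟩
    exact (continuousAt_U (by fun_prop) hg hk (by simpa using h6) e1 e2 e3 (by simpa using e4)).sub
      (continuousAt_V (by fun_prop) (by fun_prop) e3 (by simpa using e4))
  have hL : ContinuousAt (fun t => signSum τ (h + t) (x + 100 * t) (y + 10000 * t)) 0 := by
    simp only [signSum]
    refine ((ContinuousAt.add (ContinuousAt.add ?_ ?_) ?_).add ?_) <;>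
      refine hterm _ _ (by fun_prop) (by fun_prop) ?_ <;> simp only [mul_zero, add_zero] <;>
      exact hxy _ (by simp) _ (by simp)
  have hR : ContinuousAt (fun t => K τ (h + t)) 0 :=
    continuousAt_K (by fun_prop) (by simpa using h2) (by simpa using h3) (by simpa using h4)
      (by simpa using h5) (by simpa using h6)
  have hL' := hL.tendsto.mono_left (nhdsWithin_le_nhds (s := {0}ᶜ))
  have hR' := hR.tendsto.mono_left (nhdsWithin_le_nhds (s := {0}ᶜ))
  simp only [mul_zero, add_zero] at hL' hR'
  refine tendsto_nhds_unique (hL'.congr' ?_) hR'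
  filter_upwards [eventually_generic h2 h x y] with t ht using ht.signSum_eq_K

/-! ### From weights to coordinates. -/

lemma form_neg (lam p : Weight) : form lam (-p) = -form lam p := by
  simp [form]
  ring

lemma form_add (lam p q : Weight) : form lam (p + q) = form lam p + form lam q := by
  simp [form]
  ring

/-- Ensures that a sum over the finset `{ε j, -ε j}` really has two terms. -/
lemma ε_ne_neg (j : Fin 2) : ε j ≠ -ε j := fun h => by
  have := congrFun h j
  simp [ε] at this
  norm_num [self_eq_neg] at this

end C2Theta
end

theorem lemma1 (τ : UpperHalfPlane) (h : ℂ)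
    -- the denominators that depend on `h` only do not vanish
    (hh : ∀ n ∈ ({2, 3, 4, 5, 6} : Finset ℕ), C2Theta.theta1 τ ((n : ℂ) * h) ≠ 0)
    (lam : C2Theta.Weight)
    -- the denominators that depend on `lam` do not vanish
    (hlam : ∀ p ∈ ({C2Theta.ε 0, -C2Theta.ε 0} : Finset C2Theta.Weight),
      ∀ q ∈ ({C2Theta.ε 1, -C2Theta.ε 1} : Finset C2Theta.Weight),
        C2Theta.theta1 τ (2 * C2Theta.form lam p) ≠ 0 ∧
        C2Theta.theta1 τ (2 * C2Theta.form lam q) ≠ 0 ∧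
        C2Theta.theta1 τ (C2Theta.form lam (p + q)) ≠ 0 ∧
        C2Theta.theta1 τ (C2Theta.form lam (p + q) + h) ≠ 0) :
    (∑ p ∈ ({C2Theta.ε 0, -C2Theta.ε 0} : Finset C2Theta.Weight),
      ∑ q ∈ ({C2Theta.ε 1, -C2Theta.ε 1} : Finset C2Theta.Weight),
        C2Theta.U τ h (C2Theta.form lam p) (C2Theta.form lam q))
    - (∑ p ∈ ({C2Theta.ε 0, -C2Theta.ε 0} : Finset C2Theta.Weight),
      ∑ q ∈ ({C2Theta.ε 1, -C2Theta.ε 1} : Finset C2Theta.Weight),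
        (C2Theta.theta1 τ (C2Theta.form lam (p + q) - h) *
          C2Theta.theta1 τ (C2Theta.form lam (p + q) + 2 * h)) /
        (C2Theta.theta1 τ (C2Theta.form lam (p + q)) *
          C2Theta.theta1 τ (C2Theta.form lam (p + q) + h)))
    = C2Theta.K τ h := by
  have hsum : ∀ (j : Fin 2) (f : C2Theta.Weight → ℂ),
      ∑ p ∈ ({C2Theta.ε j, -C2Theta.ε j} : Finset C2Theta.Weight), f p =
        f (C2Theta.ε j) + f (-C2Theta.ε j) := fun j f =>
    Finset.sum_pair (C2Theta.ε_ne_neg j)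
  have key := C2Theta.signSum_eq_K_of_ne_zero (τ := τ) (h := h)
    (x := C2Theta.form lam (C2Theta.ε 0)) (y := C2Theta.form lam (C2Theta.ε 1))
    (by simpa using hh 2 (by simp)) (by simpa using hh 3 (by simp))
    (by simpa using hh 4 (by simp)) (by simpa using hh 5 (by simp))
    (by simpa using hh 6 (by simp)) (by
      simp only [← C2Theta.form_neg]
      intro u hu v hv
      simp only [Finset.mem_insert, Finset.mem_singleton] at hu hv
      rcases hu with rfl | rfl <;> rcases hv with rfl | rfl <;>
        simp only [← C2Theta.form_add] <;> exact hlam _ (by simp) _ (by simp))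
  rw [← key]
  simp only [hsum, C2Theta.form_add, C2Theta.form_neg, C2Theta.signSum, C2Theta.V]
  ring
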